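/- Let $A$ be a C*-algebra (not necessarily unital), with $A_+=\{x^*x:x\in A\}$ and $a\le b\Leftrightarrow b-a\in A_+$. A C*-subalgebra $B$ of $A$ is hereditary if $0\le a\le b\in B$ implies $a\in B$. Let $\mathcal{H}(A)$ be the complete lattice of hereditary C*-subalgebras of $A$, ordered by inclusion, so that $B\wedge C=B\cap C$ and $B\vee C$ is the smallest hereditary C*-subalgebra containing $B$ and $C$. Let $\mathcal{I}(A)$ be the set of closed two-sided ideals of $A$. Products of sets are sets of products, e.g. $BAC=\{bac:b\in B,a\in A,c\in C\}$. For $S\subseteq A$ put $S^\triangledown=\{a\in A: bAa=\{0\}\text{ for all }b\in S\}$. A coatom of $\mathcal{H}(A)$ is a maximal element of $\mathcal{H}(A)\setminus\{A\}$. An element $D\in\mathcal{H}(A)$ is $\wedge$-irreducible if $D=E\wedge F$ implies $D\in\{E,F\}$, for all $E,F\in\mathcal{H}(A)$, and it is a $\vee$-semicomplement of $C$ if $C\vee D=A$. An ideal $I\in\mathcal{I}(A)$ is prime if, for all $a,b\in A$, $aAb\subseteq I$ implies $a\in I$ or $b\in I$, and primitive if $I$ is the largest element of $\mathcal{I}(A)$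 contained in some coatom of $\mathcal{H}(A)$. **Theorem.** For $B,C\in\mathcal{H}(A)$, the following are equivalent. 1. $B$ and $C$ are strongly orthogonal, i.e. $BAC=\{0\}$. 2. $B^{\triangledown\triangledown}\cap C^{\triangledown\triangledown}=\{0\}$. 3. $\overline{\mathrm{span}}(ABA)\cap C=\{0\}$. 4. $ABA\cap C=\{0\}$. 5. $B\vee C=B\oplus C$, i.e. $B\vee C=B+C$ and $B\cap C=\{0\}$ (an algebraic direct sum of linear subspaces). 6. $D=(B\vee D)\wedge(C\vee D)$ for all $D\in\mathcal{H}(A)$. 7. $B\wedge D=B\wedge(C\vee D)$ for all $D\in\mathcal{H}(A)$. 8. Every $\vee$-semicomplement of $C$ in $\mathcal{H}(A)$ contains $B$. 9. Every $\wedge$-irreducible in $\mathcal{H}(A)$ contains $B$ or $C$. 10. Every coatom in $\mathcal{H}(A)$ contains $B$ or $C$. 11. Every prime $I\in\mathcal{I}(A)$ contains $B$ or $C$. 12. Every primitive $I\in\mathcal{I}(A)$ contains $B$ or $C$. 13. For all $a\in A$, $aa^*\in B$ and $a^*a\in C$ imply $a=0$. -/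

import Mathlib

open scoped Pointwise

/-- A hereditary C*-subalgebra of a C*-algebra `A`: a norm-closed *-subalgebra `B` such that
`0 ≤ a ≤ b ∈ B` implies `a ∈ B`.  The order of `A` is its canonical one, in which the positive
elements are exactly the elements `x* x`. -/
structure HereditarySubalgebra (A : Type*) [NonUnitalCStarAlgebra A] [PartialOrder A]
    [StarOrderedRing A] extends NonUnitalStarSubalgebra ℂ A where
  isClosed' : IsClosed carrier
  hereditary' : ∀ ⦃a b : A⦄, 0 ≤ a → a ≤ b → b ∈ carrier → a ∈ carrier

namespace HereditarySubalgebra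

variable {A : Type*} [NonUnitalCStarAlgebra A] [PartialOrder A] [StarOrderedRing A]

instance : SetLike (HereditarySubalgebra A) A where
  coe B := B.carrier
  coe_injective B C h := by
    cases B
    cases C
    congr
    exact SetLike.coe_injective h

/-- Hereditary C*-subalgebras are ordered by inclusion. -/
instance : PartialOrder (HereditarySubalgebra A) := .ofSetLike (HereditarySubalgebra A) A

theorem le_def {B C : HereditarySubalgebra A} : B ≤ C ↔ (B : Set A) ⊆ (C : Set A) := Iff.rfl

/-- The underlying linear subspace. -/
def toSubspace (B : HereditarySubalgebra A) : Submodule ℂ A :=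
  B.toNonUnitalStarSubalgebra.toNonUnitalSubalgebra.toSubmodule

theorem coe_toSubspace (B : HereditarySubalgebra A) : (B.toSubspace : Set A) = (B : Set A) := rfl

/-- The whole algebra. -/
instance : Top (HereditarySubalgebra A) where
  top :=
    { (⊤ : NonUnitalStarSubalgebra ℂ A) with
      isClosed' := isClosed_univ
      hereditary' := fun _ _ _ _ _ => trivial }

/-- The infimum of a family is its intersection. -/
instance : InfSet (HereditarySubalgebra A) where
  sInf S :=
    { carrier := ⋂ B ∈ S, (B : Set A)
      add_mem' := fun {a b} ha hb => by
        simp only [Set.mem_iInter] at ha hb ⊢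
        exact fun B hB => B.add_mem' (ha B hB) (hb B hB)
      zero_mem' := by
        simp only [Set.mem_iInter]
        exact fun B _ => B.zero_mem'
      mul_mem' := fun {a b} ha hb => by
        simp only [Set.mem_iInter] at ha hb ⊢
        exact fun B hB => B.mul_mem' (ha B hB) (hb B hB)
      smul_mem' := fun c a ha => by
        simp only [Set.mem_iInter] at ha ⊢
        exact fun B hB => B.smul_mem' c (ha B hB)
      star_mem' := fun {a} ha => by
        simp only [Set.mem_iInter] at ha ⊢
        exact fun B hB => B.star_mem' (ha B hB)
      isClosed' := isClosed_biInter fun B _ => B.isClosed'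
      hereditary' := fun a b h0 hab hb => by
        simp only [Set.mem_iInter] at hb ⊢
        exact fun B hB => B.hereditary' h0 hab (hb B hB) }

theorem coe_sInf (S : Set (HereditarySubalgebra A)) :
    ((sInf S : HereditarySubalgebra A) : Set A) = ⋂ B ∈ S, (B : Set A) := rfl

/-- The intersection of two hereditary C*-subalgebras. -/
instance : Min (HereditarySubalgebra A) where
  min B C :=
    { B.toNonUnitalStarSubalgebra ⊓ C.toNonUnitalStarSubalgebra with
      isClosed' := B.isClosed'.inter C.isClosed'
      hereditary' := fun _ _ h0 hab hb =>
        ⟨B.hereditary' h0 hab hb.1, C.hereditary' h0 hab hb.2⟩ }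

/-- The complete lattice of hereditary C*-subalgebras.  The infimum is the intersection, and
the supremum is the least hereditary C*-subalgebra containing the given ones. -/
instance : CompleteLattice (HereditarySubalgebra A) where
  __ := completeLatticeOfInf (HereditarySubalgebra A) fun _ =>
    ⟨fun _ hB => Set.biInter_subset_of_mem (t := fun B : HereditarySubalgebra A => (B : Set A)) hB,
      fun _ hC => Set.subset_iInter₂ fun _ hB => hC hB⟩
  inf := min
  inf_le_left _ _ := fun _ h => h.1
  inf_le_right _ _ := fun _ h => h.2
  le_inf _ _ _ h₁ h₂ := fun _ h => ⟨h₁ h, h₂ h⟩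
  top := ⊤
  le_top _ := fun _ _ => trivial

theorem coe_inf (B C : HereditarySubalgebra A) :
    ((B ⊓ C : HereditarySubalgebra A) : Set A) = (B : Set A) ∩ (C : Set A) := rfl

theorem coe_top : ((⊤ : HereditarySubalgebra A) : Set A) = Set.univ := rfl

end HereditarySubalgebra

/-- A norm-closed two-sided ideal of a C*-algebra. -/
structure ClosedIdeal (A : Type*) [NonUnitalCStarAlgebra A] extends Submodule ℂ A where
  mul_mem_left' : ∀ (a : A) ⦃x : A⦄, x ∈ carrier → a * x ∈ carrier
  mul_mem_right' : ∀ (a : A) ⦃x : A⦄, x ∈ carrier → x * a ∈ carrier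
  isClosed' : IsClosed carrier

namespace ClosedIdeal

variable {A : Type*} [NonUnitalCStarAlgebra A]

instance : SetLike (ClosedIdeal A) A where
  coe I := I.carrier
  coe_injective I J h := by
    cases I
    cases J
    congr
    exact SetLike.coe_injective h

/-- Closed ideals are ordered by inclusion. -/
instance : PartialOrder (ClosedIdeal A) := .ofSetLike (ClosedIdeal A) A

/-- A closed ideal is prime if `a A b ⊆ I` implies `a ∈ I` or `b ∈ I`.  (The whole algebra is
not excluded.) -/
def IsPrime (I : ClosedIdeal A) : Prop :=
  ∀ a b : A, (∀ x : A, a * x * b ∈ I) → a ∈ I ∨ b ∈ I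

/-- A closed ideal is primitive if it is the largest closed ideal contained in some maximal
proper hereditary C*-subalgebra. -/
def IsPrimitive [PartialOrder A] [StarOrderedRing A] (I : ClosedIdeal A) : Prop :=
  ∃ M : HereditarySubalgebra A, IsCoatom M ∧
    IsGreatest {J : ClosedIdeal A | (J : Set A) ⊆ (M : Set A)} I

end ClosedIdeal

/-- An element `p` of a lattice is ∧-irreducible if `p = q ∧ r` implies `p = q` or `p = r`.
(Unlike Mathlib's `InfIrred`, this does not exclude the maximum.) -/
def IsMeetIrreducible {P : Type*} [Lattice P] (p : P) : Prop :=
  ∀ q r : P, p = q ⊓ r → p = q ∨ p = r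

/-- `p` is a ∨-semicomplement of `q` if `p ∨ q = 1`. -/
def IsJoinSemicomplement {P : Type*} [Lattice P] [OrderTop P] (p q : P) : Prop :=
  p ⊔ q = ⊤

/-- `V` is the interior direct sum of its linear subspaces `U` and `W`. -/
def IsInteriorDirectSum {A : Type*} [AddCommGroup A] [Module ℂ A] (V U W : Submodule ℂ A) :
    Prop :=
  U ⊔ W = V ∧ U ⊓ W = ⊥

/-- The set `S^▽` of all `a` such that `b A a = {0}` for every `b ∈ S`. -/
def triangleAnnihilator {A : Type*} [NonUnitalCStarAlgebra A] (S : Set A) : Set A :=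
  {a | ∀ b ∈ S, ∀ x : A, b * x * a = 0}

/-- Strong orthogonality `B ▽ C`: the set `BAC` of products `b a c` is `{0}`. -/
def StronglyOrthogonal {A : Type*} [NonUnitalCStarAlgebra A] [PartialOrder A]
    [StarOrderedRing A] (B C : HereditarySubalgebra A) : Prop :=
  (B : Set A) * Set.univ * (C : Set A) = {0}

/-! A hereditary subalgebra `B` is recovered from the closed left ideal `L = {a | star a * a ∈ B}`
as `L ∩ star L` (`mem_of_mem_leftIdeal`), so questions about joins become questions about closed
left ideals.

If `B A C = 0`, the annihilator operation encloses `B` and `C` in closed ideals `J`, `K` with `J K =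
K J = 0`. Every closed left ideal `L` is then the intersection of the closures of `L + J` and `L +
K` (`mem_of_mem_closure_sup`). This gives the lattice identities, and these lead down to the
statement about coatoms.

Conversely, if some `b x c` is nonzero, it acts nontrivially on a simple module over the
unitization. The annihilator of that module is a prime ideal containing neither `B` nor `C`. A
suitable vector `w` with `b w ≠ 0` and `c w ≠ 0` gives a coatom containing neither. The purely
algebraic conditions all pass through the last one, applied to `a = b x c`. -/

open Unitization CStarAlgebra in
/-- A positive element `h` of a C*-algebra has left multiples `y * h` which are contractive
right approximate units, uniformly for all `c` with `star c * c ≤ h`. -/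
theorem exists_mul_approximate_unit {A : Type*} [NonUnitalCStarAlgebra A] [PartialOrder A]
    [StarOrderedRing A] {h : A} (hh : 0 ≤ h) {ε : ℝ} (hε : 0 < ε) :
    ∃ y : A, (∀ c : A, star c * c ≤ h → ‖c - c * (y * h)‖ ≤ ε) ∧
      ∀ z : A, ‖z - z * (y * h)‖ ≤ ‖z‖ := by
  -- With `y = g(h)` one has `1 - y h = k(h) = d`, and `‖c d‖² ≤ ‖d h d‖ ≤ sup k(x)² x ≤ δ`, which
  -- forces `δ = ε²`. Since `g 0 = 0`, `y` lies in `A` itself.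
  set δ : ℝ := ε ^ 2 with hδ
  have hδ0 : 0 < δ := by positivity
  have hden (x : ℝ) : δ ^ 2 + x ^ 2 ≠ 0 := by positivity
  let g : ℝ → ℝ := fun x => x / (δ ^ 2 + x ^ 2)
  let k : ℝ → ℝ := fun x => δ ^ 2 / (δ ^ 2 + x ^ 2)
  have hg : Continuous g := by
    fun_prop (disch := exact hden)
  have hk : Continuous k := by
    fun_prop (disch := exact hden)
  set H : Unitization ℂ A := (h : Unitization ℂ A) with hH
  have hH0 : 0 ≤ H := inr_nonneg_iff.mpr hh
  have hHs : IsSelfAdjoint H := .of_nonneg hH0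
  set d : Unitization ℂ A := cfc k H with hd
  have hds : IsSelfAdjoint d := cfc_predicate k H
  have hy : ((cfcₙ g h * h : A) : Unitization ℂ A) = 1 - d := by
    rw [inr_mul, real_cfcₙ_eq_cfc_inr h g (by simp [g]), ← hH, eq_sub_iff_add_eq, hd]
    nth_rewrite 2 [← cfc_id' ℝ H]
    rw [← cfc_mul g (fun x => x) H (hg.continuousOn) (by fun_prop),
      ← cfc_add (a := H) (fun x => g x * x) k (by fun_prop) (by fun_prop),
      ← cfc_one ℝ H]
    refine cfc_congr fun x _ => ?_
    have := hden x
    simp only [g, k, Pi.one_apply]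
    field_simp
    ring
  have hd1 : ‖d‖ ≤ 1 := by
    refine norm_cfc_le zero_le_one fun x _ => ?_
    have : 0 ≤ k x := by positivity
    rw [Real.norm_of_nonneg this]
    exact div_le_one_of_le₀ (by nlinarith [sq_nonneg x]) (by positivity)
  have hdHd : ‖d * H * d‖ ≤ ε ^ 2 := by
    have : d * H * d = cfc (fun x => k x * x * k x) H := by
      rw [cfc_mul (fun x => k x * x) k H (by fun_prop) (by fun_prop),
        cfc_mul k (fun x => x) H (by fun_prop) (by fun_prop), cfc_id' ℝ H]
    rw [this]
    refine norm_cfc_le (by positivity) fun x hx => ?_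
    have hx0 : 0 ≤ x := spectrum_nonneg_of_nonneg hH0 hx
    have hk0 : 0 ≤ k x := by positivity
    have hk1 : k x ≤ 1 := div_le_one_of_le₀ (by nlinarith [sq_nonneg x]) (by positivity)
    have hkx : k x * x ≤ δ := by
      simp only [k]
      rw [div_mul_eq_mul_div, div_le_iff₀ (by positivity)]
      nlinarith [mul_nonneg hδ0.le (sq_nonneg (x - δ)), mul_nonneg hδ0.le (mul_nonneg hδ0.le hx0)]
    rw [Real.norm_of_nonneg (by positivity), ← hδ]
    exact (mul_le_of_le_one_right (by positivity) hk1).trans hkx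
  have key (z : A) : ((z - z * (cfcₙ g h * h) : A) : Unitization ℂ A) = z * d := by
    rw [inr_sub, inr_mul, hy]; noncomm_ring
  refine ⟨cfcₙ g h, fun c hc => ?_, fun z => ?_⟩
  · rw [← norm_inr (𝕜 := ℂ), key]
    refine le_of_sq_le_sq ?_ hε.le
    rw [sq, ← CStarRing.norm_star_mul_self]
    refine le_trans ?_ hdHd
    refine norm_le_norm_of_nonneg_of_le (star_mul_self_nonneg _) ?_
    have : (star (c : Unitization ℂ A) * c) ≤ H := by
      rw [← inr_star, ← inr_mul]
      exact (inr_le_iff _ _ (.star_mul_self c) (.of_nonneg hh)).mpr hc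
    have := star_left_conjugate_le_conjugate this d
    rw [hds.star_eq] at this
    simpa [star_mul, mul_assoc, hds.star_eq] using this
  · rw [← norm_inr (𝕜 := ℂ), key, ← norm_inr (𝕜 := ℂ) (a := z)]
    exact (norm_mul_le _ _).trans (mul_le_of_le_one_right (norm_nonneg _) hd1)

section Approximation

variable {A : Type*} [NonUnitalCStarAlgebra A] [PartialOrder A] [StarOrderedRing A]

/-- If `star c * c ≤ h` then every closed set containing all `c * (y * h)` contains `c`. -/
theorem IsClosed.mem_of_forall_mul_mul_mem {S : Set A} (hS : IsClosed S) {c h : A}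
    (hc : star c * c ≤ h) (H : ∀ y, c * (y * h) ∈ S) : c ∈ S := by
  rw [← hS.closure_eq, Metric.mem_closure_iff]
  intro ε hε
  obtain ⟨y, hy, -⟩ := exists_mul_approximate_unit ((star_mul_self_nonneg c).trans hc) (half_pos hε)
  refine ⟨_, H y, ?_⟩
  rw [dist_eq_norm]
  exact (hy c hc).trans_lt (half_lt_self hε)

/-- Adjoint form of the preceding approximation, applied to `star c` with `h = c * star c`. -/
theorem IsClosed.mem_of_forall_mul_star_mul_mem {S : Set A} (hS : IsClosed S) {c : A}
    (H : ∀ y, c * star c * y * c ∈ S) : c ∈ S := by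
  have hS' : IsClosed {x : A | star x ∈ S} := hS.preimage continuous_star
  have := hS'.mem_of_forall_mul_mul_mem (c := star c) (le_refl _) fun y => by
    simpa [mul_assoc] using H (star y)
  simpa using this

omit [PartialOrder A] [StarOrderedRing A] in
theorem eq_zero_of_mul_star_mul_self_eq_zero {a : A} (h : a * star a * a = 0) : a = 0 := by
  have h2 : star (star a * a) * (star a * a) = 0 := by
    rw [star_mul, star_star, mul_assoc, ← mul_assoc a, h, mul_zero]
  rwa [CStarRing.star_mul_self_eq_zero_iff, CStarRing.star_mul_self_eq_zero_iff] at h2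

theorem exists_eq_star_mul_self {a : A} (ha : 0 ≤ a) : ∃ c : A, a = star c * c :=
  CStarAlgebra.nonneg_iff_eq_star_mul_self.mp ha

end Approximation

/-! ### Closed left ideals and hereditary subalgebras -/

/-- A norm-closed left ideal of a C*-algebra. -/
structure IsClosedLeftIdeal {A : Type*} [NonUnitalCStarAlgebra A] (L : Submodule ℂ A) : Prop where
  isClosed : IsClosed (L : Set A)
  mul_mem : ∀ (a : A) ⦃x : A⦄, x ∈ L → a * x ∈ L

namespace IsClosedLeftIdeal

variable {A : Type*} [NonUnitalCStarAlgebra A]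

theorem topologicalClosure {L : Submodule ℂ A} (hL : ∀ (a : A) ⦃x : A⦄, x ∈ L → a * x ∈ L) :
    IsClosedLeftIdeal L.topologicalClosure where
  isClosed := L.isClosed_topologicalClosure
  mul_mem a x hx := map_mem_closure (f := fun x => a * x) (by fun_prop) hx fun _ hy => hL a hy

theorem sup_mul_mem {L J : Submodule ℂ A} (hL : IsClosedLeftIdeal L) (hJ : IsClosedLeftIdeal J)
    (a : A) ⦃x : A⦄ (hx : x ∈ L ⊔ J) : a * x ∈ L ⊔ J := by
  obtain ⟨l, hl, j, hj, rfl⟩ := Submodule.mem_sup.mp hx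
  rw [mul_add]
  exact Submodule.add_mem_sup (hL.mul_mem a hl) (hJ.mul_mem a hj)

theorem closure_sup {L J : Submodule ℂ A} (hL : IsClosedLeftIdeal L) (hJ : IsClosedLeftIdeal J) :
    IsClosedLeftIdeal (L ⊔ J).topologicalClosure :=
  topologicalClosure (hL.sup_mul_mem hJ)

variable [PartialOrder A] [StarOrderedRing A]

theorem mem_of_star_mul_self_le {L : Submodule ℂ A} (hL : IsClosedLeftIdeal L) {c h : A}
    (hh : h ∈ L) (hc : star c * c ≤ h) : c ∈ L :=
  hL.isClosed.mem_of_forall_mul_mul_mem hc fun _ => hL.mul_mem _ (hL.mul_mem _ hh)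

end IsClosedLeftIdeal

namespace HereditarySubalgebra

variable {A : Type*} [NonUnitalCStarAlgebra A] [PartialOrder A] [StarOrderedRing A]

variable {B : HereditarySubalgebra A} {a b : A}

theorem isClosed (B : HereditarySubalgebra A) : IsClosed (B : Set A) := B.isClosed'
protected theorem zero_mem (B : HereditarySubalgebra A) : (0 : A) ∈ B := B.zero_mem'
protected theorem add_mem (ha : a ∈ B) (hb : b ∈ B) : a + b ∈ B := B.add_mem' ha hb
protected theorem mul_mem (ha : a ∈ B) (hb : b ∈ B) : a * b ∈ B := B.mul_mem' ha hb
protected theorem smul_mem (c : ℂ) (ha : a ∈ B) : c • a ∈ B := B.smul_mem' c ha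
protected theorem star_mem (ha : a ∈ B) : star a ∈ B := B.star_mem' ha
protected theorem neg_mem (ha : a ∈ B) : -a ∈ B := by simpa using B.smul_mem (-1) ha
protected theorem sub_mem (ha : a ∈ B) (hb : b ∈ B) : a - b ∈ B := by
  simpa [sub_eq_add_neg] using B.add_mem ha (B.neg_mem hb)
theorem mem_of_le (h0 : 0 ≤ a) (hab : a ≤ b) (hb : b ∈ B) : a ∈ B := B.hereditary' h0 hab hb

theorem mem_toSubspace : a ∈ B.toSubspace ↔ a ∈ B := Iff.rfl

theorem star_mul_nonneg_mul_mem (hb : b ∈ B) {p : A} (hp : 0 ≤ p) : star b * p * b ∈ B := by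
  refine B.mem_of_le (star_left_conjugate_nonneg hp b)
    (CStarAlgebra.star_left_conjugate_le_norm_smul (.of_nonneg hp)) ?_
  rw [← Complex.coe_smul]
  exact B.smul_mem _ (B.mul_mem (B.star_mem hb) hb)

theorem star_mul_mul_mem (hb : b ∈ B) (x : A) : star b * x * b ∈ B := by
  have hx : x ∈ Submodule.span ℂ {a : A | 0 ≤ a} := by simp [CStarAlgebra.span_nonneg]
  induction hx using Submodule.span_induction with
  | mem p hp => exact B.star_mul_nonneg_mul_mem hb hp
  | zero => simpa using B.zero_mem
  | add x y _ _ hx hy => rw [mul_add, add_mul]; exact B.add_mem hx hy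
  | smul c x _ hx => rw [mul_smul_comm, smul_mul_assoc]; exact B.smul_mem c hx

/-- A hereditary C*-subalgebra satisfies `B A B ⊆ B`. -/
theorem mul_mul_mem {c : A} (hb : b ∈ B) (x : A) (hc : c ∈ B) : b * x * c ∈ B := by
  have h (u v : A) (hu : u ∈ B) (hv : v ∈ B) : star u * x * v + star v * x * u ∈ B := by
    have := B.sub_mem (B.star_mul_mul_mem (B.add_mem hu hv) x)
      (B.add_mem (B.star_mul_mul_mem hu x) (B.star_mul_mul_mem hv x))
    convert this using 1
    rw [star_add]; noncomm_ring
  have h1 := h (star b) c (B.star_mem hb) hc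
  -- Polarization: replacing `c` by `i c` and multiplying by `-i` flips the sign of the second
  -- summand, so half the sum with `h1` isolates `b x c`.
  have h2 := B.smul_mem (-Complex.I) (h (star b) (Complex.I • c) (B.star_mem hb) (B.smul_mem _ hc))
  have h3 := B.smul_mem (1 / 2) (B.add_mem h1 h2)
  convert h3 using 1
  simp only [star_star, star_smul, mul_smul_comm, smul_mul_assoc, smul_add, smul_smul,
    RCLike.star_def, Complex.conj_I]
  simp only [neg_mul, mul_neg, Complex.I_mul_I, neg_neg, mul_one]
  rw [add_add_add_comm, ← add_smul, ← add_smul]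
  norm_num

/-- The closed left ideal `{a | star a * a ∈ B}` of a hereditary C*-subalgebra. -/
def leftIdeal (B : HereditarySubalgebra A) : Submodule ℂ A where
  carrier := {a | star a * a ∈ B}
  zero_mem' := by simpa using B.zero_mem
  add_mem' {a b} ha hb := by
    have h2 : star (a + b) * (a + b) ≤
        (star a * a + star b * b) + (star a * a + star b * b) := by
      rw [← sub_nonneg]
      convert star_mul_self_nonneg (a - b) using 1
      rw [star_add, star_sub]; noncomm_ring
    exact B.mem_of_le (star_mul_self_nonneg _) h2
      (B.add_mem (B.add_mem ha hb) (B.add_mem ha hb))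
  smul_mem' c a ha := by
    simp only [Set.mem_ofPred_eq, star_smul, mul_smul_comm, smul_mul_assoc] at ha ⊢
    exact B.smul_mem _ (B.smul_mem _ ha)

theorem mem_leftIdeal : a ∈ B.leftIdeal ↔ star a * a ∈ B := Iff.rfl

theorem isClosedLeftIdeal_leftIdeal (B : HereditarySubalgebra A) :
    IsClosedLeftIdeal B.leftIdeal where
  isClosed := B.isClosed.preimage (f := fun a : A => star a * a) (by fun_prop)
  mul_mem x a ha := by
    rw [mem_leftIdeal] at ha ⊢
    have := CStarAlgebra.star_left_conjugate_le_norm_smul (b := star x * x) (a := a)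
      (.star_mul_self x)
    refine B.mem_of_le (star_mul_self_nonneg _) (b := (‖star x * x‖ : ℝ) • (star a * a)) ?_ ?_
    · simpa [mul_assoc] using this
    · rw [← Complex.coe_smul]
      exact B.smul_mem _ ha

theorem mem_leftIdeal_of_mem (ha : a ∈ B) : a ∈ B.leftIdeal := B.mul_mem (B.star_mem ha) ha

/-- Approximating twice, `a` is a limit of elements `a a* y a`, and each of these is a limit of
elements `(a a*) (y a z) (a* a)` of `B A B ⊆ B`. -/
theorem mem_of_mem_leftIdeal (ha : a ∈ B.leftIdeal) (ha' : star a ∈ B.leftIdeal) : a ∈ B := by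
  rw [mem_leftIdeal] at ha ha'
  rw [star_star] at ha'
  refine B.isClosed.mem_of_forall_mul_star_mul_mem fun y => ?_
  refine (B.isClosed.preimage (f := fun z : A => a * star a * y * z) (by fun_prop)
    ).mem_of_forall_mul_mul_mem (le_refl (star a * a)) fun z => ?_
  have := B.mul_mul_mem ha' (y * a * z) ha
  simpa [mul_assoc] using this

/-- The hereditary C*-subalgebra `L ∩ star L` of a closed left ideal `L`. -/
def ofLeftIdeal (L : Submodule ℂ A) (hL : IsClosedLeftIdeal L) : HereditarySubalgebra A where
  carrier := {a | a ∈ L ∧ star a ∈ L}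
  zero_mem' := by simp
  add_mem' ha hb := ⟨L.add_mem ha.1 hb.1, by rw [star_add]; exact L.add_mem ha.2 hb.2⟩
  mul_mem' ha hb := ⟨hL.mul_mem _ hb.1, by rw [star_mul]; exact hL.mul_mem _ ha.2⟩
  smul_mem' c _ ha := ⟨L.smul_mem c ha.1, by rw [star_smul]; exact L.smul_mem _ ha.2⟩
  star_mem' ha := ⟨ha.2, by rw [star_star]; exact ha.1⟩
  isClosed' := hL.isClosed.inter (hL.isClosed.preimage continuous_star)
  hereditary' a b h0 hab hb := by
    obtain ⟨c, rfl⟩ := exists_eq_star_mul_self h0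
    have := hL.mul_mem (star c) (hL.mem_of_star_mul_self_le hb.1 hab)
    exact ⟨this, by simpa using this⟩

theorem le_ofLeftIdeal {L : Submodule ℂ A} {hL : IsClosedLeftIdeal L}
    (h : ∀ b ∈ B, b ∈ L) : B ≤ ofLeftIdeal L hL :=
  fun b hb => ⟨h b hb, h _ (B.star_mem hb)⟩

theorem eq_top_of_leftIdeal (h : ∀ a, a ∈ B.leftIdeal) : B = ⊤ :=
  top_le_iff.mp fun a _ => B.mem_of_mem_leftIdeal (h a) (h _)

/-- A closed *-subalgebra `S` with `S A S ⊆ S` is hereditary. -/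
def ofMulMulMem (S : NonUnitalStarSubalgebra ℂ A) (hS : IsClosed (S : Set A))
    (h : ∀ s ∈ S, ∀ x, ∀ t ∈ S, s * x * t ∈ S) : HereditarySubalgebra A where
  __ := S
  isClosed' := hS
  hereditary' a b h0 hab hb := by
    obtain ⟨c, rfl⟩ := exists_eq_star_mul_self h0
    -- Since `c* c ≤ b`, `c` is a limit of elements `z = c y b`, for which `z* z = b (y* c* c y) b`
    -- lies in `S A S`.
    refine (hS.preimage (f := fun z : A => star z * z) (by fun_prop)).mem_of_forall_mul_mul_mem
      hab fun y => ?_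
    have hb0 : star b = b := (IsSelfAdjoint.of_nonneg (h0.trans hab)).star_eq
    have := h b hb (star y * star c * c * y) b hb
    simpa [mul_assoc, hb0] using this

end HereditarySubalgebra

/-! ### Closed ideals and annihilators -/

namespace ClosedIdeal

variable {A : Type*} [NonUnitalCStarAlgebra A]

theorem isClosedLeftIdeal (I : ClosedIdeal A) : IsClosedLeftIdeal I.toSubmodule :=
  ⟨I.isClosed', I.mul_mem_left'⟩

/-- The annihilator `S^▽` as a closed ideal. -/
def annihilator (S : Set A) : ClosedIdeal A where
  carrier := triangleAnnihilator S
  zero_mem' _ _ _ := mul_zero _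
  add_mem' ha ha' b hb x := by rw [mul_add, ha b hb, ha' b hb, add_zero]
  smul_mem' c a ha b hb x := by rw [mul_smul_comm, ha b hb, smul_zero]
  mul_mem_left' y a ha b hb x := by rw [← mul_assoc, mul_assoc b, ha b hb]
  mul_mem_right' y a ha b hb x := by rw [← mul_assoc, ha b hb, zero_mul]
  isClosed' := by
    simp only [triangleAnnihilator, Set.ofPred_forall]
    exact isClosed_biInter fun b _ => isClosed_iInter fun x =>
      isClosed_eq (by fun_prop) continuous_const

theorem coe_annihilator (S : Set A) : (annihilator S : Set A) = triangleAnnihilator S := rfl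

theorem mem_annihilator {S : Set A} {a : A} :
    a ∈ annihilator S ↔ ∀ b ∈ S, ∀ x, b * x * a = 0 := Iff.rfl

variable [PartialOrder A] [StarOrderedRing A]

/-- `a*` is a limit of elements `a* y (a a*)`, which lie in the ideal. -/
theorem star_mem {I : ClosedIdeal A} {a : A} (ha : a ∈ I) : star a ∈ I :=
  I.isClosed'.mem_of_forall_mul_mul_mem (le_refl _) fun y =>
    I.mul_mem_left' _ (I.mul_mem_left' _ (by simpa using I.mul_mem_right' (star a) ha))

omit [PartialOrder A] [StarOrderedRing A] in
theorem mul_eq_zero_of_mem_annihilator {S : Set A} {a b : A} (hb : b ∈ S)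
    (ha : a ∈ annihilator S) : b * a = 0 := by
  refine eq_zero_of_mul_star_mul_self_eq_zero ?_
  have := ha b hb (a * star (b * a) * b)
  simpa [mul_assoc] using this

omit [PartialOrder A] [StarOrderedRing A] in
theorem mul_eq_zero_of_mem_annihilator' {S : Set A} {a b : A} (hb : b ∈ S)
    (ha : a ∈ annihilator S) : a * b = 0 := by
  refine eq_zero_of_mul_star_mul_self_eq_zero ?_
  have := ha b hb (star (a * b))
  simpa [mul_assoc] using congr(a * $this * b)

omit [PartialOrder A] [StarOrderedRing A] in
theorem subset_annihilator_comm {S T : Set A} (h : S ⊆ annihilator T) : T ⊆ annihilator S := by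
  intro t ht s hs x
  exact mul_eq_zero_of_mem_annihilator' ht ((annihilator T).mul_mem_right' x (h hs))

omit [PartialOrder A] [StarOrderedRing A] in
theorem annihilator_anti {S T : Set A} (h : S ⊆ T) :
    (annihilator T : Set A) ⊆ annihilator S := fun _ ha b hb => ha b (h hb)

end ClosedIdeal

/-! ### Distributivity over orthogonal ideals -/

section Distributivity

variable {A : Type*} [NonUnitalCStarAlgebra A] [PartialOrder A] [StarOrderedRing A]

/-- If `J` and `K` are closed ideals with `K J = 0`, then every closed left ideal `L` is the
intersection of the closures of `L + J` and `L + K`. -/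
theorem IsClosedLeftIdeal.mem_of_mem_closure_sup {L : Submodule ℂ A} (hL : IsClosedLeftIdeal L)
    {J K : ClosedIdeal A} (hKJ : ∀ k ∈ K, ∀ j ∈ J, k * j = 0) {x : A}
    (hJ : x ∈ (L ⊔ J.toSubmodule).topologicalClosure)
    (hK : x ∈ (L ⊔ K.toSubmodule).topologicalClosure) : x ∈ L := by
  have main (ε : ℝ) (hε : 0 < ε) : ∃ e ∈ L, ‖x - e‖ ^ 2 ≤ ε * (4 * ‖x‖ + 4 * ε) := by
    obtain ⟨p, hp, hxp⟩ := Metric.mem_closure_iff.mp hJ ε hε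
    obtain ⟨l₁, hl₁, j, hj, rfl⟩ := Submodule.mem_sup.mp hp
    obtain ⟨q, hq, hxq⟩ := Metric.mem_closure_iff.mp hK ε hε
    obtain ⟨l₂, hl₂, k, hk, rfl⟩ := Submodule.mem_sup.mp hq
    rw [dist_eq_norm] at hxp hxq
    have h₁ := star_mul_self_nonneg l₁
    have h₂ := star_mul_self_nonneg l₂
    -- The sum dominates both `l₁* l₁` and `l₂* l₂`, so a single `e ∈ L` nearly fixes `l₁` and `l₂`.
    -- Hence `z = x - x e` is within `2ε` of both `j' ∈ J` and `k' ∈ K`.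
    obtain ⟨y, hy, hy'⟩ := exists_mul_approximate_unit (add_nonneg h₁ h₂) hε
    set e : A := y * (star l₁ * l₁ + star l₂ * l₂) with he
    have heL : e ∈ L :=
      hL.mul_mem _ (L.add_mem (hL.mul_mem _ hl₁) (hL.mul_mem _ hl₂))
    have hz (l u : A) (hl : star l * l ≤ star l₁ * l₁ + star l₂ * l₂) (hu : ‖x - (l + u)‖ < ε) :
        ‖(x - x * e) - (u - u * e)‖ ≤ 2 * ε := by
      have : (x - x * e) - (u - u * e) =
          ((x - (l + u)) - (x - (l + u)) * e) + (l - l * e) := by noncomm_ring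
      rw [this]
      have := norm_add_le ((x - (l + u)) - (x - (l + u)) * e) (l - l * e)
      linarith [hy' (x - (l + u)), hy l hl]
    have hzj := hz l₁ j (le_add_of_nonneg_right h₂) hxp
    have hzk := hz l₂ k (le_add_of_nonneg_left h₁) hxq
    set z := x - x * e with hz_def
    have hzx : ‖z‖ ≤ ‖x‖ := hy' x
    set j' := j - j * e
    set k' := k - k * e
    have hj' : j' ∈ J := J.sub_mem hj (J.mul_mem_right' _ hj)
    have hk' : k' ∈ K := K.sub_mem hk (K.mul_mem_right' _ hk)
    have hkj : star k' * j' = 0 := hKJ _ (ClosedIdeal.star_mem hk') _ hj'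
    have hj'n : ‖j'‖ ≤ ‖x‖ + 2 * ε := by
      have := norm_sub_norm_le j' z
      rw [norm_sub_rev j' z] at this
      linarith
    refine ⟨x * e, hL.mul_mem _ heL, ?_⟩
    rw [← hz_def, sq, ← CStarRing.norm_star_mul_self]
    -- Orthogonality `k'* j' = 0` leaves only terms with a small factor.
    have : star z * z = star z * (z - j') + star (z - k') * j' := by
      rw [star_sub z, sub_mul, hkj, mul_sub (star z) z j', sub_zero, sub_add_cancel]
    rw [this]
    calc _ ≤ ‖star z * (z - j')‖ + ‖star (z - k') * j'‖ := norm_add_le _ _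
      _ ≤ ‖x‖ * (2 * ε) + (2 * ε) * (‖x‖ + 2 * ε) := by
        gcongr
        · exact (norm_mul_le _ _).trans (by rw [norm_star]; gcongr)
        · exact (norm_mul_le _ _).trans (by rw [norm_star]; gcongr)
      _ = _ := by ring
  suffices x ∈ closure (L : Set A) by rwa [hL.isClosed.closure_eq] at this
  rw [Metric.mem_closure_iff]
  intro r hr
  obtain ⟨ε, hε0, hε⟩ : ∃ ε : ℝ, 0 < ε ∧ ε * (4 * ‖x‖ + 4 * ε) < r ^ 2 := by
    have ht : Filter.Tendsto (fun ε : ℝ => ε * (4 * ‖x‖ + 4 * ε)) (nhdsWithin 0 (Set.Ioi 0))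
        (nhds 0) := by
      have : Continuous (fun ε : ℝ => ε * (4 * ‖x‖ + 4 * ε)) := by fun_prop
      simpa using (this.tendsto 0).mono_left nhdsWithin_le_nhds
    obtain ⟨ε, h1, h2⟩ :=
      ((ht.eventually_lt_const (by positivity : (0 : ℝ) < r ^ 2)).and self_mem_nhdsWithin).exists
    exact ⟨ε, h2, h1⟩
  obtain ⟨e, he, hxe⟩ := main ε hε0
  refine ⟨e, he, ?_⟩
  rw [dist_eq_norm]
  exact lt_of_pow_lt_pow_left₀ 2 hr.le (hxe.trans_lt hε)

namespace HereditarySubalgebra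

variable {B C D : HereditarySubalgebra A}

theorem stronglyOrthogonal_iff :
    StronglyOrthogonal B C ↔ ∀ b ∈ B, ∀ x, ∀ c ∈ C, b * x * c = 0 := by
  constructor
  · intro h b hb x c hc
    have : b * x * c ∈ (B : Set A) * Set.univ * (C : Set A) :=
      Set.mul_mem_mul (Set.mul_mem_mul hb (Set.mem_univ x)) hc
    rw [h] at this
    exact this
  · intro h
    refine Set.eq_singleton_iff_unique_mem.mpr ⟨?_, ?_⟩
    · exact ⟨0, ⟨0, B.zero_mem, 0, trivial, zero_mul 0⟩, 0, C.zero_mem, zero_mul 0⟩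
    · rintro _ ⟨_, ⟨b, hb, x, -, rfl⟩, c, hc, rfl⟩
      exact h b hb x c hc

theorem stronglyOrthogonal_iff_subset_annihilator :
    StronglyOrthogonal B C ↔ (C : Set A) ⊆ ClosedIdeal.annihilator (B : Set A) := by
  rw [stronglyOrthogonal_iff]
  exact ⟨fun h c hc b hb x => h b hb x c hc, fun h b hb x c hc => h hc b hb x⟩

/-- Strongly orthogonal hereditary C*-subalgebras are contained in orthogonal closed ideals. -/
theorem _root_.StronglyOrthogonal.exists_closedIdeal (h : StronglyOrthogonal B C) :
    ∃ J K : ClosedIdeal A, (B : Set A) ⊆ J ∧ (C : Set A) ⊆ K ∧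
      (∀ j ∈ J, ∀ k ∈ K, j * k = 0) ∧ ∀ k ∈ K, ∀ j ∈ J, k * j = 0 := by
  rw [stronglyOrthogonal_iff_subset_annihilator] at h
  refine ⟨.annihilator (ClosedIdeal.annihilator (B : Set A)), .annihilator (B : Set A),
    ClosedIdeal.subset_annihilator_comm subset_rfl, h,
    fun j hj k hk => ClosedIdeal.mul_eq_zero_of_mem_annihilator' hk hj,
    fun k hk j hj => ClosedIdeal.mul_eq_zero_of_mem_annihilator hk hj⟩

/-- An upper bound for the join, in terms of left ideals, suffices for distributivity. -/
theorem sup_le_ofLeftIdeal_closure {J : ClosedIdeal A} (hB : (B : Set A) ⊆ J) :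
    B ⊔ D ≤ ofLeftIdeal _ (D.isClosedLeftIdeal_leftIdeal.closure_sup J.isClosedLeftIdeal) :=
  sup_le
    (le_ofLeftIdeal fun _ hb => Submodule.le_topologicalClosure _ (Submodule.mem_sup_right (hB hb)))
    (le_ofLeftIdeal fun _ hd => Submodule.le_topologicalClosure _
      (Submodule.mem_sup_left (D.mem_leftIdeal_of_mem hd)))

theorem _root_.StronglyOrthogonal.eq_sup_inf_sup (h : StronglyOrthogonal B C)
    (D : HereditarySubalgebra A) : D = (B ⊔ D) ⊓ (C ⊔ D) := by
  refine le_antisymm (le_inf le_sup_right le_sup_right) ?_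
  obtain ⟨J, K, hBJ, hCK, -, hKJ⟩ := h.exists_closedIdeal
  rintro x ⟨hxB, hxC⟩
  have h1 := sup_le_ofLeftIdeal_closure (D := D) hBJ hxB
  have h2 := sup_le_ofLeftIdeal_closure (D := D) hCK hxC
  exact D.mem_of_mem_leftIdeal
    (D.isClosedLeftIdeal_leftIdeal.mem_of_mem_closure_sup hKJ h1.1 h2.1)
    (D.isClosedLeftIdeal_leftIdeal.mem_of_mem_closure_sup hKJ h1.2 h2.2)

theorem _root_.StronglyOrthogonal.inf_eq_zero (h : StronglyOrthogonal B C) {x : A} (hB : x ∈ B)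
    (hC : x ∈ C) : x = 0 :=
  eq_zero_of_mul_star_mul_self_eq_zero (stronglyOrthogonal_iff.mp h x hB (star x) x hC)

end HereditarySubalgebra

end Distributivity

/-! ### Coatoms and primitive ideals -/

section Coatom

variable {A : Type*} [NonUnitalCStarAlgebra A] [PartialOrder A] [StarOrderedRing A]

namespace HereditarySubalgebra

variable {B C M : HereditarySubalgebra A}

/-- Maximality passes to left ideals: `a* a` lies in `L ∩ star L` but not in `M`. -/
theorem eq_top_of_lt_ofLeftIdeal (hM : IsCoatom M) {L : Submodule ℂ A} (hL : IsClosedLeftIdeal L)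
    (hML : M.leftIdeal ≤ L) {a : A} (haL : a ∈ L) (ha : a ∉ M.leftIdeal) (x : A) : x ∈ L := by
  have h : M < ofLeftIdeal L hL := by
    refine lt_of_le_of_ne (le_ofLeftIdeal fun b hb => hML (M.mem_leftIdeal_of_mem hb)) ?_
    rintro h
    refine ha ?_
    rw [mem_leftIdeal, h]
    exact ⟨hL.mul_mem _ haL, by simpa using hL.mul_mem _ haL⟩
  have : x ∈ ofLeftIdeal L hL := by rw [hM.2 _ h]; trivial
  exact this.1

/-- If `J` and `K` are closed ideals with `J K = 0`, then a coatom contains `J` or `K`. -/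
theorem subset_or_subset_of_isCoatom (hM : IsCoatom M) {J K : ClosedIdeal A}
    (hJK : ∀ j ∈ J, ∀ k ∈ K, j * k = 0) : (J : Set A) ⊆ M ∨ (K : Set A) ⊆ M := by
  have hsub {I : ClosedIdeal A} (h : I.toSubmodule ≤ M.leftIdeal) : (I : Set A) ⊆ M :=
    fun a ha => M.mem_of_mem_leftIdeal (h ha) (h (ClosedIdeal.star_mem ha))
  by_cases hK : K.toSubmodule ≤ M.leftIdeal
  · exact Or.inr (hsub hK)
  obtain ⟨k, hk, hkM⟩ := Set.not_subset.mp hK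
  refine Or.inl (hsub fun j hj => ?_)
  have hL := M.isClosedLeftIdeal_leftIdeal
  refine hL.isClosed.mem_of_forall_mul_mul_mem (le_refl _) fun y => ?_
  -- The left ideal of `M` plus `K` is dense, and left multiplication by `j` kills `K`, so `j A`
  -- lies in the left ideal of `M`.
  have hy := eq_top_of_lt_ofLeftIdeal hM (hL.closure_sup K.isClosedLeftIdeal)
    (le_sup_left.trans (Submodule.le_topologicalClosure _))
    (Submodule.le_topologicalClosure _ (Submodule.mem_sup_right hk)) hkM (y * (star j * j))
  have := map_mem_closure (f := fun z : A => j * z) (t := (M.leftIdeal : Set A)) (by fun_prop) hy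
    fun z hz => by
      obtain ⟨l, hl, k, hk, rfl⟩ := Submodule.mem_sup.mp hz
      simp only [mul_add]
      rw [hJK j hj k hk, add_zero]
      exact hL.mul_mem _ hl
  rwa [hL.isClosed.closure_eq] at this

theorem _root_.StronglyOrthogonal.subset_of_isPrimitive (h : StronglyOrthogonal B C) {I : ClosedIdeal A}
    (hI : I.IsPrimitive) : (B : Set A) ⊆ I ∨ (C : Set A) ⊆ I := by
  obtain ⟨M, hM, hIM⟩ := hI
  obtain ⟨J, K, hBJ, hCK, hJK, -⟩ := h.exists_closedIdeal
  exact (subset_or_subset_of_isCoatom hM hJK).imp (fun h => hBJ.trans (hIM.2 h))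
    fun h => hCK.trans (hIM.2 h)

/-- The largest closed ideal contained in a hereditary C*-subalgebra. -/
def core (M : HereditarySubalgebra A) : ClosedIdeal A where
  -- Without a unit, the first three conditions are not instances of the last.
  carrier := {a | a ∈ M ∧ (∀ x, x * a ∈ M) ∧ (∀ y, a * y ∈ M) ∧ ∀ x y, x * a * y ∈ M}
  zero_mem' := by simp [M.zero_mem]
  add_mem' {a b} ha hb := by
    refine ⟨M.add_mem ha.1 hb.1, fun x => ?_, fun y => ?_, fun x y => ?_⟩
    · rw [mul_add]; exact M.add_mem (ha.2.1 x) (hb.2.1 x)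
    · rw [add_mul]; exact M.add_mem (ha.2.2.1 y) (hb.2.2.1 y)
    · rw [mul_add, add_mul]; exact M.add_mem (ha.2.2.2 x y) (hb.2.2.2 x y)
  smul_mem' c a ha := by
    refine ⟨M.smul_mem c ha.1, fun x => ?_, fun y => ?_, fun x y => ?_⟩
    · rw [mul_smul_comm]; exact M.smul_mem c (ha.2.1 x)
    · rw [smul_mul_assoc]; exact M.smul_mem c (ha.2.2.1 y)
    · rw [mul_smul_comm, smul_mul_assoc]; exact M.smul_mem c (ha.2.2.2 x y)
  mul_mem_left' z a ha := by
    refine ⟨ha.2.1 z, fun x => ?_, fun y => ha.2.2.2 z y, fun x y => ?_⟩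
    · rw [← mul_assoc]; exact ha.2.1 _
    · rw [← mul_assoc]; exact ha.2.2.2 _ _
  mul_mem_right' z a ha := by
    refine ⟨ha.2.2.1 z, fun x => ?_, fun y => ?_, fun x y => ?_⟩
    · rw [← mul_assoc]; exact ha.2.2.2 x z
    · rw [mul_assoc]; exact ha.2.2.1 _
    · rw [← mul_assoc, mul_assoc _ z]; exact ha.2.2.2 _ _
  isClosed' := by
    simp only [Set.ofPred_and, Set.ofPred_forall]
    refine M.isClosed.inter (.inter (isClosed_iInter fun x => ?_) (.inter
      (isClosed_iInter fun y => ?_) (isClosed_iInter fun x => isClosed_iInter fun y => ?_)))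
    · exact M.isClosed.preimage (f := fun a : A => x * a) (by fun_prop)
    · exact M.isClosed.preimage (f := fun a : A => a * y) (by fun_prop)
    · exact M.isClosed.preimage (f := fun a : A => x * a * y) (by fun_prop)

theorem core_subset (M : HereditarySubalgebra A) : (M.core : Set A) ⊆ M := fun _ h => h.1

theorem isGreatest_core (M : HereditarySubalgebra A) :
    IsGreatest {J : ClosedIdeal A | (J : Set A) ⊆ M} M.core :=
  ⟨M.core_subset, fun J hJ _ ha => ⟨hJ ha, fun x => hJ (J.mul_mem_left' x ha),
    fun y => hJ (J.mul_mem_right' y ha),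
    fun x y => hJ (J.mul_mem_right' y (J.mul_mem_left' x ha))⟩⟩

end HereditarySubalgebra

end Coatom

/-! ### Direct sums and the algebraic conditions -/

section DirectSum

variable {A : Type*} [NonUnitalCStarAlgebra A] [PartialOrder A] [StarOrderedRing A]

namespace HereditarySubalgebra

variable {B C : HereditarySubalgebra A}

omit [PartialOrder A] [StarOrderedRing A] in
theorem norm_le_norm_add {b c : A} (h : star b * c = 0) : ‖b‖ ≤ ‖b + c‖ := by
  rcases eq_or_ne b 0 with rfl | hb
  · simp
  have : star b * (b + c) = star b * b := by rw [mul_add, h, add_zero]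
  have h2 : ‖b‖ * ‖b‖ ≤ ‖b‖ * ‖b + c‖ := by
    rw [← CStarRing.norm_star_mul_self, ← this]
    exact (norm_mul_le _ _).trans (by rw [norm_star])
  exact le_of_mul_le_mul_left h2 (norm_pos_iff.mpr hb)

/-- Addition `B × C → A` is bounded below for the max norm, so its range is complete. -/
theorem isClosed_sup_toSubspace (h : ∀ b ∈ B, ∀ c ∈ C, b * c = 0) :
    IsClosed ((B.toSubspace ⊔ C.toSubspace : Submodule ℂ A) : Set A) := by
  have : CompleteSpace B.toSubspace := B.isClosed.completeSpace_coe
  have : CompleteSpace C.toSubspace := C.isClosed.completeSpace_coe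
  let f : B.toSubspace × C.toSubspace →ₗ[ℂ] A :=
    B.toSubspace.subtype.coprod C.toSubspace.subtype
  have hf : Continuous f := by
    change Continuous fun p : B.toSubspace × C.toSubspace => (p.1 : A) + p.2
    fun_prop
  have hanti : AntilipschitzWith 1 f := by
    refine AddMonoidHomClass.antilipschitz_of_bound f fun p => ?_
    rw [NNReal.coe_one, one_mul, Prod.norm_def]
    change max ‖(p.1 : A)‖ ‖(p.2 : A)‖ ≤ ‖(p.1 : A) + p.2‖
    have h1 : star (p.1 : A) * p.2 = 0 := h _ (B.star_mem p.1.2) _ p.2.2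
    have h2 : star (p.2 : A) * p.1 = 0 := by simpa using congr(star $h1)
    exact max_le (norm_le_norm_add h1) (by rw [add_comm]; exact norm_le_norm_add h2)
  have := hanti.isClosed_range (uniformContinuous_addMonoidHom_of_continuous hf)
  rwa [← LinearMap.coe_range, LinearMap.range_coprod, Submodule.range_subtype,
    Submodule.range_subtype] at this

theorem _root_.StronglyOrthogonal.mul_eq_zero (h : StronglyOrthogonal B C) {b c : A} (hb : b ∈ B)
    (hc : c ∈ C) : b * c = 0 := by
  rw [stronglyOrthogonal_iff_subset_annihilator] at h
  exact ClosedIdeal.mul_eq_zero_of_mem_annihilator hb (h hc)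

theorem _root_.StronglyOrthogonal.symm (h : StronglyOrthogonal B C) : StronglyOrthogonal C B := by
  rw [stronglyOrthogonal_iff] at h ⊢
  intro c hc x b hb
  have := congr(star $(h _ (B.star_mem hb) (star x) _ (C.star_mem hc)))
  simpa [mul_assoc] using this

/-- Cross terms vanish, so `S = B + C` is a closed *-subalgebra with `S A S ⊆ S`, hence hereditary.
-/
theorem _root_.StronglyOrthogonal.isInteriorDirectSum (h : StronglyOrthogonal B C) :
    IsInteriorDirectSum (B ⊔ C).toSubspace B.toSubspace C.toSubspace := by
  have hBC := stronglyOrthogonal_iff.mp h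
  have hCB := stronglyOrthogonal_iff.mp h.symm
  have hmem {x : A} : x ∈ B.toSubspace ⊔ C.toSubspace ↔ ∃ b ∈ B, ∃ c ∈ C, b + c = x :=
    Submodule.mem_sup
  let S : NonUnitalStarSubalgebra ℂ A :=
    { B.toSubspace ⊔ C.toSubspace with
      mul_mem' := by
        rintro x y hx hy
        obtain ⟨b, hb, c, hc, rfl⟩ := hmem.mp hx
        obtain ⟨b', hb', c', hc', rfl⟩ := hmem.mp hy
        refine hmem.mpr ⟨b * b', B.mul_mem hb hb', c * c', C.mul_mem hc hc', ?_⟩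
        rw [add_mul, mul_add, mul_add, h.mul_eq_zero hb hc', h.symm.mul_eq_zero hc hb']
        abel
      star_mem' := by
        rintro x hx
        obtain ⟨b, hb, c, hc, rfl⟩ := hmem.mp hx
        exact hmem.mpr ⟨star b, B.star_mem hb, star c, C.star_mem hc, (star_add _ _).symm⟩ }
  have hS (x : A) : x ∈ S ↔ ∃ b ∈ B, ∃ c ∈ C, b + c = x := hmem
  let N : HereditarySubalgebra A := ofMulMulMem S
    (isClosed_sup_toSubspace fun b hb c hc => h.mul_eq_zero hb hc) <| by
      intro s hs x t ht
      obtain ⟨b, hb, c, hc, rfl⟩ := (hS s).mp hs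
      obtain ⟨b', hb', c', hc', rfl⟩ := (hS t).mp ht
      refine (hS _).mpr ⟨b * x * b', B.mul_mul_mem hb x hb', c * x * c', C.mul_mul_mem hc x hc', ?_⟩
      rw [add_mul, add_mul, mul_add, mul_add, hBC b hb x c' hc', hCB c hc x b' hb']
      abel
  have hN (x : A) : x ∈ N ↔ x ∈ B.toSubspace ⊔ C.toSubspace := Iff.rfl
  refine ⟨le_antisymm (sup_le (le_sup_left (a := B)) (le_sup_right (a := B))) ?_, ?_⟩
  · have : B ⊔ C ≤ N := sup_le (fun b hb => (hN b).mpr (Submodule.mem_sup_left hb))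
      fun c hc => (hN c).mpr (Submodule.mem_sup_right hc)
    exact this
  · exact (Submodule.eq_bot_iff _).mpr fun x hx => h.inf_eq_zero hx.1 hx.2

/-- The hypotheses put `a` in `B ∨ C`, so `a = b + c`. As `a` and `c` lie in the left ideal of `C`,
so does `b`; thus `b* b ∈ B ∩ C = 0`. Then `a = c` and `c c* ∈ B ∩ C = 0`. -/
theorem eq_zero_of_isInteriorDirectSum
    (h : IsInteriorDirectSum (B ⊔ C).toSubspace B.toSubspace C.toSubspace) {a : A}
    (hB : a * star a ∈ B) (hC : star a * a ∈ C) : a = 0 := by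
  have ha : a ∈ B ⊔ C := (B ⊔ C).mem_of_mem_leftIdeal (le_sup_right (a := B) hC)
    ((B ⊔ C).mem_leftIdeal.mpr (by simpa using le_sup_left (b := C) hB))
  rw [← mem_toSubspace, ← h.1] at ha
  obtain ⟨b, hb, c, hc, rfl⟩ := Submodule.mem_sup.mp ha
  have h0 (x : A) (hxB : x ∈ B) (hxC : x ∈ C) : x = 0 :=
    (Submodule.eq_bot_iff _).mp h.2 x ⟨hxB, hxC⟩
  have hb0 : b = 0 := by
    rw [← CStarRing.star_mul_self_eq_zero_iff]
    refine h0 _ (B.mul_mem (B.star_mem hb) hb) (C.mem_leftIdeal.mp ?_)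
    simpa using C.leftIdeal.sub_mem (C.mem_leftIdeal.mpr hC) (C.mem_leftIdeal_of_mem hc)
  have hc0 : c = 0 := by
    rw [← CStarRing.mul_star_self_eq_zero_iff]
    refine h0 _ ?_ (C.mul_mem hc (C.star_mem hc))
    simpa [hb0] using hB
  rw [hb0, hc0, add_zero]

theorem stronglyOrthogonal_of_forall (h : ∀ a : A, a * star a ∈ B → star a * a ∈ C → a = 0) :
    StronglyOrthogonal B C := by
  refine stronglyOrthogonal_iff.mpr fun b hb x c hc => h _ ?_ ?_
  · have := B.mul_mul_mem hb (x * c * star c * star x) (B.star_mem hb)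
    simpa [mul_assoc] using this
  · have := C.mul_mul_mem (C.star_mem hc) (star x * star b * b * x) hc
    simpa [mul_assoc] using this

/-- Forward, `C ⊆ B^▽` gives `B^▽▽ ⊆ C^▽`, which meets `C^▽▽` trivially. Backward, `b x c` lies in
both ideals. -/
theorem stronglyOrthogonal_iff_annihilator_annihilator :
    StronglyOrthogonal B C ↔ triangleAnnihilator (triangleAnnihilator (B : Set A)) ∩
      triangleAnnihilator (triangleAnnihilator (C : Set A)) = {0} := by
  simp only [← ClosedIdeal.coe_annihilator]
  constructor
  · intro h
    rw [stronglyOrthogonal_iff_subset_annihilator] at h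
    refine Set.eq_singleton_iff_unique_mem.mpr 
      ⟨⟨(ClosedIdeal.annihilator _).zero_mem', (ClosedIdeal.annihilator _).zero_mem'⟩, ?_⟩
    rintro x ⟨hxB, hxC⟩
    have hx : x ∈ ClosedIdeal.annihilator (C : Set A) := ClosedIdeal.annihilator_anti h hxB
    exact eq_zero_of_mul_star_mul_self_eq_zero (hxC x hx (star x))
  · intro h
    refine stronglyOrthogonal_iff.mpr fun b hb x c hc => ?_
    have hmem : b * x * c ∈ ({0} : Set A) := by
      rw [← h]
      refine ⟨?_, ?_⟩
      · rw [mul_assoc]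
        exact ClosedIdeal.mul_mem_right' _ _ (ClosedIdeal.subset_annihilator_comm subset_rfl hb)
      · exact ClosedIdeal.mul_mem_left' _ _ (ClosedIdeal.subset_annihilator_comm subset_rfl hc)
    exact hmem

theorem _root_.StronglyOrthogonal.closure_span_inter (h : StronglyOrthogonal B C) :
    closure (Submodule.span ℂ (Set.univ * (B : Set A) * Set.univ) : Set A) ∩ (C : Set A) = {0} := by
  obtain ⟨J, K, hBJ, hCK, hJK, -⟩ := h.exists_closedIdeal
  refine Set.eq_singleton_iff_unique_mem.mpr
    ⟨⟨subset_closure (Submodule.zero_mem _), C.zero_mem⟩, ?_⟩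
  rintro x ⟨hx, hxC⟩
  have hJ : closure (Submodule.span ℂ (Set.univ * (B : Set A) * Set.univ) : Set A) ⊆ J := by
    refine closure_minimal (SetLike.coe_subset_coe.mpr (Submodule.span_le
      (p := J.toSubmodule).mpr ?_)) J.isClosed'
    rintro _ ⟨_, ⟨y, -, b, hb, rfl⟩, z, -, rfl⟩
    exact J.mul_mem_right' z (J.mul_mem_left' y (hBJ hb))
  rw [← CStarRing.mul_star_self_eq_zero_iff]
  exact hJK x (hJ hx) _ (hCK (C.star_mem hxC))

theorem mul_mul_inter_eq_zero_of_closure_span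
    (h : closure (Submodule.span ℂ (Set.univ * (B : Set A) * Set.univ) : Set A) ∩ (C : Set A) = {0}) :
    (Set.univ * (B : Set A) * Set.univ) ∩ (C : Set A) = {0} := by
  refine Set.eq_singleton_iff_unique_mem.mpr
    ⟨⟨⟨0, ⟨0, trivial, 0, B.zero_mem, zero_mul 0⟩, 0, trivial, zero_mul 0⟩, C.zero_mem⟩, ?_⟩
  rintro x ⟨hx, hxC⟩
  have : x ∈ ({0} : Set A) := by
    rw [← h]
    exact ⟨subset_closure (Submodule.subset_span hx), hxC⟩
  exact this

/-- `(a* a)² = a* (a a*) a` lies in `A B A ∩ C`. -/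
theorem eq_zero_of_mul_mul_inter (h : (Set.univ * (B : Set A) * Set.univ) ∩ (C : Set A) = {0})
    {a : A} (hB : a * star a ∈ B) (hC : star a * a ∈ C) : a = 0 := by
  have : star a * (a * star a) * a ∈ ({0} : Set A) := by
    rw [← h]
    refine ⟨⟨_, ⟨star a, trivial, _, hB, rfl⟩, a, trivial, rfl⟩, ?_⟩
    simpa [mul_assoc] using C.mul_mem hC hC
  have h2 : star (star a * a) * (star a * a) = 0 := by
    simpa [mul_assoc] using this
  rwa [CStarRing.star_mul_self_eq_zero_iff, CStarRing.star_mul_self_eq_zero_iff] at h2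

end HereditarySubalgebra

end DirectSum

/-! ### Simple modules, prime ideals and coatoms -/

section SimpleModule

open Unitization

/-- A nonzero element of a unital C*-algebra lies outside some maximal left ideal. -/
theorem exists_isMaximal_notMem {U : Type*} [CStarAlgebra U] {z : U} (hz : z ≠ 0) :
    ∃ P : Ideal U, P.IsMaximal ∧ z ∉ P := by
  let _ : PartialOrder U := CStarAlgebra.spectralOrder U
  have _ : StarOrderedRing U := CStarAlgebra.spectralOrderedRing U
  have : Nontrivial U := ⟨z, 0, hz⟩
  set h : U := star z * z with hh
  have hh0 : h ≠ 0 := by rwa [hh, Ne, CStarRing.star_mul_self_eq_zero_iff]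
  have hs : IsSelfAdjoint h := .star_mul_self z
  have hspec : ‖h‖ ∈ spectrum ℝ h :=
    CStarAlgebra.norm_mem_spectrum_of_nonneg (star_mul_self_nonneg z)
  set t : U := algebraMap ℝ U ‖h‖ with ht
  have hts : star (t - h) = t - h := by
    rw [star_sub, hs.star_eq, ht, ← algebraMap_star_comm, star_trivial]
  -- A left inverse of the self-adjoint `t - h` would make it invertible, although `‖h‖` is in the
  -- spectrum. A maximal left ideal containing both `t - h` and `z` would contain the nonzero scalar
  -- `t`.
  have htop : Ideal.span {t - h} ≠ ⊤ := by
    intro htop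
    obtain ⟨y, hy⟩ := Ideal.mem_span_singleton'.mp ((Ideal.eq_top_iff_one _).mp htop)
    have hy' : (t - h) * star y = 1 := by simpa [hts] using congr(star $hy)
    refine hspec ?_
    exact (isUnit_iff_exists_and_exists.mpr ⟨⟨_, hy'⟩, ⟨_, hy⟩⟩ : IsUnit (t - h))
  obtain ⟨P, hP, hle⟩ := Ideal.exists_le_maximal _ htop
  refine ⟨P, hP, fun hzP => hP.ne_top ?_⟩
  have htP : t ∈ P := by
    have h1 : t - h ∈ P := hle (Ideal.mem_span_singleton_self _)
    have h2 : h ∈ P := P.mul_mem_left _ hzP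
    simpa using P.add_mem h1 h2
  rw [Ideal.eq_top_iff_one]
  have := P.mul_mem_left (algebraMap ℝ U ‖h‖⁻¹) htP
  rwa [ht, ← map_mul, inv_mul_cancel₀ (norm_ne_zero_iff.mpr hh0), map_one] at this

/-- A nonzero element of a C*-algebra acts nontrivially on some simple module over the
unitization. -/
theorem exists_isSimpleModule {A : Type*} [NonUnitalCStarAlgebra A] {z : A} (hz : z ≠ 0) :
    ∃ P : Ideal (Unitization ℂ A), IsSimpleModule (Unitization ℂ A) (Unitization ℂ A ⧸ P) ∧
      ∃ v : Unitization ℂ A ⧸ P, (z : Unitization ℂ A) • v ≠ 0 := by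
  obtain ⟨P, hP, hzP⟩ := exists_isMaximal_notMem (z := (z : Unitization ℂ A))
    fun h => hz (inr_injective h)
  refine ⟨P, isSimpleModule_iff_isCoatom.mpr hP.out, Submodule.Quotient.mk 1, ?_⟩
  rw [← Submodule.Quotient.mk_smul, Ne, Submodule.Quotient.mk_eq_zero]
  simpa using hzP

variable {A : Type*} [NonUnitalCStarAlgebra A] {V : Type*} [AddCommGroup V]
  [Module (Unitization ℂ A) V] [IsSimpleModule (Unitization ℂ A) V]

omit [IsSimpleModule (Unitization ℂ A) V] in
theorem inr_mul_smul (a b : A) (v : V) :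
    ((a * b : A) : Unitization ℂ A) • v = (a : Unitization ℂ A) • (b : Unitization ℂ A) • v := by
  rw [inr_mul, mul_smul]

theorem exists_mul_inr_eq_inr (r : Unitization ℂ A) (a : A) :
    ∃ x : A, r * (a : Unitization ℂ A) = x := by
  induction r with
  | inl_add_inr t y =>
    exact ⟨t • a + y * a, by rw [add_mul, inl_mul_inr, ← inr_mul, inr_add]⟩

theorem exists_inr_mul_eq_inr (a : A) (r : Unitization ℂ A) :
    ∃ x : A, (a : Unitization ℂ A) * r = x := by
  induction r with
  | inl_add_inr t y =>
    exact ⟨t • a + a * y, by rw [mul_add, inr_mul_inl, ← inr_mul, inr_add]⟩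

/-- Simplicity gives `u = r η` and `v = s (a r) η` with `r`, `s` in the unitization; `s a r` lies in
`A` because `A` is an ideal there. -/
theorem exists_inr_smul_eq {a : A} {u η : V} (ha : (a : Unitization ℂ A) • u ≠ 0) (hη : η ≠ 0)
    (v : V) : ∃ x : A, (x : Unitization ℂ A) • η = v := by
  obtain ⟨r, rfl⟩ := IsSimpleModule.toSpanSingleton_surjective (Unitization ℂ A) hη u
  obtain ⟨p, hp⟩ := exists_inr_mul_eq_inr a r
  rw [LinearMap.toSpanSingleton_apply, ← mul_smul, hp] at ha
  obtain ⟨s, rfl⟩ := IsSimpleModule.toSpanSingleton_surjective (Unitization ℂ A) ha v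
  obtain ⟨x, hx⟩ := exists_mul_inr_eq_inr s p
  exact ⟨x, by rw [LinearMap.toSpanSingleton_apply, ← mul_smul, hx]⟩

/-- The left ideal of elements annihilating a vector of a module over the unitization. -/
def annihilatorVector {A V : Type*} [NonUnitalCStarAlgebra A] [AddCommGroup V]
    [Module (Unitization ℂ A) V] (w : V) : Submodule ℂ A where
  carrier := {a | (a : Unitization ℂ A) • w = 0}
  zero_mem' := by simp
  add_mem' {a b} ha hb := by
    rw [Set.mem_ofPred_eq] at ha hb ⊢
    rw [inr_add, add_smul, ha, hb, add_zero]
  smul_mem' c a ha := by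
    rw [Set.mem_ofPred_eq] at ha ⊢
    rw [inr_smul, ← smul_one_mul c (a : Unitization ℂ A), mul_smul, ha, smul_zero]

omit [IsSimpleModule (Unitization ℂ A) V] in
theorem mem_annihilatorVector {w : V} {a : A} :
    a ∈ annihilatorVector w ↔ (a : Unitization ℂ A) • w = 0 := Iff.rfl

/-- For `w ≠ 0` the annihilator in the unitization is a maximal left ideal, hence closed, so no
topology on the module is needed. -/
theorem isClosedLeftIdeal_annihilatorVector (w : V) :
    IsClosedLeftIdeal (annihilatorVector (A := A) w) where
  isClosed := by
    rcases eq_or_ne w 0 with rfl | hw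
    · convert isClosed_univ
      exact Set.eq_univ_of_forall fun a => smul_zero _
    · have := IsSimpleModule.ker_toSpanSingleton_isMaximal (Unitization ℂ A) hw
      exact (Ideal.IsMaximal.isClosed
        (I := LinearMap.ker (LinearMap.toSpanSingleton (Unitization ℂ A) V w))).preimage
        (isometry_inr (𝕜 := ℂ) (A := A)).continuous
  mul_mem a x hx := by
    rw [mem_annihilatorVector] at hx ⊢
    rw [inr_mul_smul, hx, smul_zero]

variable (A V) in
/-- The annihilator of a simple module over the unitization. -/
def annihilatorModule : ClosedIdeal A where
  __ := ⨅ v : V, annihilatorVector (A := A) v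
  mul_mem_left' x a ha := by
    simp only [AddSubsemigroup.mem_carrier, AddSubmonoid.mem_toSubsemigroup,
      Submodule.mem_toAddSubmonoid, Submodule.mem_iInf] at ha ⊢
    exact fun v => (isClosedLeftIdeal_annihilatorVector v).mul_mem x (ha v)
  mul_mem_right' x a ha := by
    simp only [AddSubsemigroup.mem_carrier, AddSubmonoid.mem_toSubsemigroup,
      Submodule.mem_toAddSubmonoid, Submodule.mem_iInf] at ha ⊢
    intro v
    rw [mem_annihilatorVector, inr_mul_smul]
    exact ha _
  isClosed' := by
    have : ((⨅ v : V, annihilatorVector (A := A) v : Submodule ℂ A) : Set A) =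
        ⋂ v : V, (annihilatorVector (A := A) v : Set A) := Submodule.coe_iInf _
    change IsClosed ((⨅ v : V, annihilatorVector (A := A) v : Submodule ℂ A) : Set A)
    rw [this]
    exact isClosed_iInter fun v => (isClosedLeftIdeal_annihilatorVector v).isClosed

theorem mem_annihilatorModule {a : A} :
    a ∈ annihilatorModule A V ↔ ∀ v : V, (a : Unitization ℂ A) • v = 0 :=
  Submodule.mem_iInf _

theorem isPrime_annihilatorModule : (annihilatorModule A V).IsPrime := by
  intro a b h
  by_contra! H
  simp only [mem_annihilatorModule, not_forall] at H
  obtain ⟨⟨u, hu⟩, v, hv⟩ := H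
  obtain ⟨x, hx⟩ := exists_inr_smul_eq hu hv u
  have := mem_annihilatorModule.mp (h x) v
  rw [inr_mul_smul, inr_mul_smul, hx] at this
  exact hu this

variable [PartialOrder A] [StarOrderedRing A]

open HereditarySubalgebra

/-- A strictly larger `N` has some `n` with `n w ≠ 0`. For any `x`, transitivity gives `y n w = x
w`, so `x - y n` kills `w` and `x` lies in the left ideal of `N`. -/
theorem isCoatom_ofLeftIdeal_annihilatorVector {a : A} {w : V}
    (ha : (a : Unitization ℂ A) • w ≠ 0) :
    IsCoatom (ofLeftIdeal (annihilatorVector w) (isClosedLeftIdeal_annihilatorVector (A := A) w)) := by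
  refine ⟨fun h => ?_, fun N hN => ?_⟩
  · have : a ∈ ofLeftIdeal (annihilatorVector w)
      (isClosedLeftIdeal_annihilatorVector (A := A) w) := by rw [h]; trivial
    exact ha this.1
  · obtain ⟨hle, n, hnN, hn⟩ := Set.ssubset_iff_exists.mp hN
    obtain ⟨n, hnN, hnw⟩ : ∃ n ∈ N, (n : Unitization ℂ A) • w ≠ 0 := by
      by_contra! H
      exact hn ⟨H n hnN, H _ (N.star_mem hnN)⟩
    have hL := N.isClosedLeftIdeal_leftIdeal
    have hsub : annihilatorVector w ≤ N.leftIdeal := fun x hx => by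
      have := (isClosedLeftIdeal_annihilatorVector w).mul_mem (star x) hx
      exact hle ⟨this, by simpa using this⟩
    refine eq_top_of_leftIdeal fun x => ?_
    obtain ⟨y, hy⟩ := exists_inr_smul_eq ha hnw ((x : Unitization ℂ A) • w)
    rw [← inr_mul_smul] at hy
    have h1 : x - y * n ∈ annihilatorVector w := by
      rw [mem_annihilatorVector, inr_sub, sub_smul, hy, sub_self]
    simpa using N.leftIdeal.add_mem (hsub h1) (hL.mul_mem y (N.mem_leftIdeal_of_mem hnN))

theorem stronglyOrthogonal_of_forall_isPrime {B C : HereditarySubalgebra A}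
    (h : ∀ I : ClosedIdeal A, I.IsPrime → (B : Set A) ⊆ (I : Set A) ∨ (C : Set A) ⊆ (I : Set A)) :
    StronglyOrthogonal B C := by
  refine stronglyOrthogonal_iff.mpr fun b hb x c hc => ?_
  by_contra hz
  obtain ⟨P, hP, v, hv⟩ := exists_isSimpleModule hz
  refine hv ?_
  rcases h _ (isPrime_annihilatorModule (A := A) (V := Unitization ℂ A ⧸ P)) with h | h
  · rw [mul_assoc, inr_mul_smul]
    exact mem_annihilatorModule.mp (h hb) _
  · rw [inr_mul_smul, mem_annihilatorModule.mp (h hc) v, smul_zero]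

theorem stronglyOrthogonal_of_forall_isCoatom {B C : HereditarySubalgebra A}
    (h : ∀ D : HereditarySubalgebra A, IsCoatom D → B ≤ D ∨ C ≤ D) : StronglyOrthogonal B C := by
  refine stronglyOrthogonal_iff.mpr fun b hb x c hc => ?_
  by_contra hz
  obtain ⟨P, hP, v, hv⟩ := exists_isSimpleModule hz
  have hcv : (c : Unitization ℂ A) • v ≠ 0 := fun h0 => hv (by rw [inr_mul_smul, h0, smul_zero])
  obtain ⟨η, hη⟩ : ∃ η : Unitization ℂ A ⧸ P, (b : Unitization ℂ A) • η ≠ 0 :=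
    ⟨_, by rwa [mul_assoc, inr_mul_smul] at hv⟩
  -- The kernels of `b` and `c` are proper subgroups, and two of these cannot cover the module.
  obtain ⟨w, hbw, hcw⟩ : ∃ w : Unitization ℂ A ⧸ P,
      (b : Unitization ℂ A) • w ≠ 0 ∧ (c : Unitization ℂ A) • w ≠ 0 := by
    by_cases hbv : (b : Unitization ℂ A) • v = 0
    · by_cases hcη : (c : Unitization ℂ A) • η = 0
      · exact ⟨v + η, by rwa [smul_add, hbv, zero_add], by rwa [smul_add, hcη, add_zero]⟩
      · exact ⟨η, hη, hcη⟩
    · exact ⟨v, hbv, hcv⟩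
  rcases h _ (isCoatom_ofLeftIdeal_annihilatorVector hbw) with h | h
  · exact hbw (h hb).1
  · exact hcw (h hc).1

end SimpleModule

/-! ### The equivalences -/

theorem IsCoatom.isMeetIrreducible {P : Type*} [Lattice P] [OrderTop P] {p : P}
    (hp : IsCoatom p) : IsMeetIrreducible p := by
  intro q r h
  rcases hp.le_iff.mp (h.le.trans inf_le_left) with rfl | hq
  · exact Or.inr (by rwa [top_inf_eq] at h)
  · exact Or.inl hq.symm

theorem mainTheorem3 {A : Type*} [NonUnitalCStarAlgebra A] [PartialOrder A] [StarOrderedRing A]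
    (B C : HereditarySubalgebra A) :
    List.TFAE [
      StronglyOrthogonal B C,
      triangleAnnihilator (triangleAnnihilator (B : Set A)) ∩
        triangleAnnihilator (triangleAnnihilator (C : Set A)) = {0},
      closure (Submodule.span ℂ (Set.univ * (B : Set A) * Set.univ) : Set A) ∩ (C : Set A) = {0},
      (Set.univ * (B : Set A) * Set.univ) ∩ (C : Set A) = {0},
      IsInteriorDirectSum (B ⊔ C).toSubspace B.toSubspace C.toSubspace,
      ∀ D : HereditarySubalgebra A, D = (B ⊔ D) ⊓ (C ⊔ D),
      ∀ D : HereditarySubalgebra A, B ⊓ D = B ⊓ (C ⊔ D),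
      ∀ D : HereditarySubalgebra A, IsJoinSemicomplement D C → B ≤ D,
      ∀ D : HereditarySubalgebra A, IsMeetIrreducible D → B ≤ D ∨ C ≤ D,
      ∀ D : HereditarySubalgebra A, IsCoatom D → B ≤ D ∨ C ≤ D,
      ∀ I : ClosedIdeal A, I.IsPrime → (B : Set A) ⊆ (I : Set A) ∨ (C : Set A) ⊆ (I : Set A),
      ∀ I : ClosedIdeal A, I.IsPrimitive → (B : Set A) ⊆ (I : Set A) ∨ (C : Set A) ⊆ (I : Set A),
      ∀ a : A, a * star a ∈ B → star a * a ∈ C → a = 0] := by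
  open HereditarySubalgebra in
  tfae_have 1 ↔ 2 := stronglyOrthogonal_iff_annihilator_annihilator
  tfae_have 1 → 3 := fun h => h.closure_span_inter
  tfae_have 3 → 4 := mul_mul_inter_eq_zero_of_closure_span
  tfae_have 4 → 13 := fun h _ => eq_zero_of_mul_mul_inter h
  tfae_have 13 → 1 := stronglyOrthogonal_of_forall
  tfae_have 1 → 5 := fun h => h.isInteriorDirectSum
  tfae_have 5 → 13 := fun h _ => eq_zero_of_isInteriorDirectSum h
  tfae_have 1 → 6 := fun h => h.eq_sup_inf_sup
  tfae_have 6 → 7 := fun h D => by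
    refine le_antisymm (inf_le_inf_left _ le_sup_right) (le_inf inf_le_left ?_)
    exact (inf_le_inf_right _ le_sup_left).trans (h D).ge
  tfae_have 7 → 8 := fun h D hD => by
    have h2 := h D
    rw [sup_comm, show D ⊔ C = ⊤ from hD, inf_top_eq] at h2
    exact inf_eq_left.mp h2
  tfae_have 8 → 10 := fun h D hD => by
    by_cases hC : C ≤ D
    · exact Or.inr hC
    -- A coatom not containing `C` is a join-semicomplement of `C`.
    · exact Or.inl (h D (hD.2 _ (left_lt_sup.mpr hC)))
  tfae_have 6 → 9 := fun h D hD =>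
    (hD _ _ (h D)).imp (fun h => le_sup_left.trans h.ge) fun h => le_sup_left.trans h.ge
  tfae_have 9 → 10 := fun h D hD => h D hD.isMeetIrreducible
  tfae_have 10 → 1 := stronglyOrthogonal_of_forall_isCoatom
  tfae_have 1 → 11 := fun h I hI => by
    rw [stronglyOrthogonal_iff] at h
    by_contra! H
    obtain ⟨⟨b, hb, hbI⟩, c, hc, hcI⟩ := And.imp Set.not_subset.mp Set.not_subset.mp H
    refine (hI b c fun x => ?_).elim hbI hcI
    rw [h b hb x c hc]
    exact I.zero_mem'
  tfae_have 11 → 1 := stronglyOrthogonal_of_forall_isPrime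
  tfae_have 1 → 12 := fun h _ => h.subset_of_isPrimitive
  tfae_have 12 → 10 := fun h M hM =>
    (h M.core ⟨M, hM, M.isGreatest_core⟩).imp (fun h => h.trans M.core_subset)
      fun h => h.trans M.core_subset
  tfae_finish
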